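/- Let $n\ge 0$. For a graph $G$ with $n$ vertices let $\mathrm{Part}(G)\vdash n$ be the partition formed by the numbers of vertices of its connected components, and let $\ell(\lambda)$ be the number of parts of a partition $\lambda$. Let $$X_G=\sum_{\kappa}\prod_{v\in V(G)}x_{\kappa(v)}$$ be the chromatic symmetric function (the sum is over all proper colorings $\kappa:V(G)\to\mathbb{Z}^+$), and let $$U_G(x,y)=\sum_{A\subseteq E(G)}\Big(\prod_{i=1}^{n}x_i^{c_i(A)}\Big)(y-1)^{|A|-n+k(A)}$$ be the $U$-polynomial, where $k(A)$ is the number of connected components of the spanning subgraph $(V(G),A)$ and $c_i(A)$ is the number of those with exactly $i$ vertices. For $\lambda=(\lambda_1,\dots,\lambda_\ell)\vdash n$ write $[\lambda]U_G\in\mathbb{Q}[y]$ for the coefficient of $x_{\lambda_1}\cdots x_{\lambda_\ell}$ in $U_G$ (for a forest this is a constant). Let $B=\{X_{G_\lambda}\mid\lambda\vdash n\}$ be a forest-basis: for every $\lambda\vdash n$, $G_\lambda$ is a forest with $\mathrm{Part}(G_\lambda)=\lambda$. For a forest $F$ with $n$ vertices and $\mathrm{Part}(F)=\mu$ let $[\lambda]X_{F,B}\in\mathbb{Q}$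 be the coefficients in the expansion $X_F=\sum_{\lambda\vdash n}[\lambda]X_{F,B}\,X_{G_\lambda}$, and for an integer $k\ge 0$ put $$X^k_{F,B}=\sum_{\lambda\vdash n,\ \ell(\lambda)\le\ell(\mu)+k}[\lambda]X_{F,B}\,X_{G_\lambda}.$$ Let $F_1,F_2$ be forests with $n$ vertices such that $\mathrm{Part}(F_1)=\mathrm{Part}(F_2)=\mu$, and suppose that $X^k_{F_1,B}-X^k_{F_2,B}=0$ for some integer $k\ge 0$. Then the expansions of $X_{F_1}$ and $X_{F_2}$ in $B$ exist and are unique, and: 1. There are $t\ge 0$ and finite families (repetitions allowed) of forests $P_1,\dots,P_t$ and $N_1,\dots,N_t$ with $n$ vertices such that $\ell(\mathrm{Part}(P_i))=\ell(\mathrm{Part}(N_i))=\ell(\mu)+k+1$ for all $i$, and $$X_{F_1}-X_{F_2}=\sum_{i=1}^{t}X_{P_i}-\sum_{i=1}^{t}X_{N_i}\quad\text{and}\quad U_{F_1}-U_{F_2}=\sum_{i=1}^{t}U_{P_i}-\sum_{i=1}^{t}U_{N_i}.$$ 2. For all $\lambda\vdash n$ with $\ell(\lambda)\le\ell(\mu)+k+1$,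 $$[\lambda]X_{F_1,B}-[\lambda]X_{F_2,B}=[\lambda]U_{F_1}-[\lambda]U_{F_2}.$$ -/

import Mathlib

/-- The chromatic symmetric function `X_G = ∑_κ ∏_v x_{κ(v)}` of a graph on a finite vertex set,
the sum ranging over all proper colorings `κ` of `G` by positive integers, as a formal power series
in the variables `x_1, x_2, …` with rational coefficients: the coefficient of a monomial `m` is the
number of proper colorings `κ` with `∏_v x_{κ(v)} = m`. -/
noncomputable def SimpleGraph.csf {V : Type*} [Fintype V] (G : SimpleGraph V) :
    MvPowerSeries ℕ+ ℚ :=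
  fun m => (Nat.card {κ : G.Coloring ℕ+ // ∑ v, Finsupp.single (κ v) 1 = m} : ℚ)

/-- Only finitely many proper colorings contribute to a given monomial. -/
theorem SimpleGraph.finite_coloring_of_monomial {V : Type*} [Fintype V] (G : SimpleGraph V)
    (m : ℕ+ →₀ ℕ) : Finite {κ : G.Coloring ℕ+ // ∑ v, Finsupp.single (κ v) 1 = m} := by
  classical
  refine Finite.of_injective
    (β := V → m.support)
    (fun κ v => ⟨κ.1 v, ?_⟩) ?_
  · rw [Finsupp.mem_support_iff]
    intro h
    have h' := DFunLike.congr_fun κ.2 (κ.1 v)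
    rw [h, Finsupp.finsetSum_apply] at h'
    have := (Finset.sum_eq_zero_iff.mp h') v (Finset.mem_univ v)
    simp at this
  · intro κ κ' h
    apply Subtype.ext
    ext v
    have := congrFun h v
    simpa using this

open scoped Classical in
/-- The partition `Part(G)` of `n` formed by the numbers of vertices of the connected components
of a graph `G` with `n` vertices. -/
noncomputable def SimpleGraph.part {n : ℕ} (G : SimpleGraph (Fin n)) : n.Partition where
  parts := (Finset.univ : Finset G.ConnectedComponent).val.map (fun c => c.supp.ncard)
  parts_pos := by
    intro i hi
    obtain ⟨c, -, rfl⟩ := Multiset.mem_map.mp hi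
    exact (Set.ncard_pos (Set.toFinite _)).mpr c.nonempty_supp
  parts_sum := by
    change ∑ c : G.ConnectedComponent, c.supp.ncard = n
    have h := Finset.card_eq_sum_card_fiberwise (s := (Finset.univ : Finset (Fin n)))
      (t := (Finset.univ : Finset G.ConnectedComponent)) (f := G.connectedComponentMk)
      (fun _ _ => Finset.mem_coe.mpr (Finset.mem_univ _))
    rw [Finset.card_univ, Fintype.card_fin] at h
    refine Eq.trans ?_ h.symm
    refine Finset.sum_congr rfl fun c _ => ?_
    rw [← Set.ncard_coe_finset]
    congr 1
    ext v
    simp [SimpleGraph.ConnectedComponent.mem_supp_iff]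

/-- The length `ℓ(ν)`, the number of parts of the partition `ν`. -/
def Nat.Partition.length {n : ℕ} (ν : n.Partition) : ℕ := Multiset.card ν.parts

/-- The `U`-polynomial
`U_G(x, y) = ∑_{A ⊆ E(G)} (∏_{i=1}^{|V|} x_i ^ c_i(A)) (y - 1) ^ (|A| - r(A))`
as a polynomial in the variables `x_i` over `ℚ[y]`. Here `c_i(A)` is the number of connected
components with `i` vertices of the spanning subgraph `(V, A)`, and `r(A) = |V| - k(A)`, where
`k(A)` is its number of connected components. The natural subtraction below is exact, since
`|V| ≤ |A| + k(A)` always holds. -/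
noncomputable def SimpleGraph.uPoly {V : Type*} [Fintype V] (G : SimpleGraph V) :
    MvPolynomial ℕ (Polynomial ℚ) :=
  open scoped Classical in
  ∑ A ∈ G.edgeFinset.powerset,
    (∏ i ∈ Finset.Icc 1 (Fintype.card V),
      MvPolynomial.X i ^
        Nat.card {c : (SimpleGraph.fromEdgeSet (A : Set (Sym2 V))).ConnectedComponent //
          c.supp.ncard = i}) *
    MvPolynomial.C ((Polynomial.X - 1) ^
      (A.card + Nat.card (SimpleGraph.fromEdgeSet (A : Set (Sym2 V))).ConnectedComponent
        - Fintype.card V))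

/-- The coefficient `[ν]U_G` of the monomial `x_ν = x_{ν_1} ⋯ x_{ν_ℓ}` in `U_G(x, y)`, an element
of `ℚ[y]`. -/
noncomputable def SimpleGraph.uCoeff {n : ℕ} (G : SimpleGraph (Fin n)) (ν : n.Partition) :
    Polynomial ℚ :=
  MvPolynomial.coeff (Multiset.toFinsupp ν.parts) G.uPoly

/-- The assignment `ν ↦ B ν` of graphs to the partitions of `n` defines a chromatic-basis
`{X_{B ν} | ν ⊢ n}`: each `B ν` has partition `ν`. -/
def IsChromaticBasis {n : ℕ} (B : n.Partition → SimpleGraph (Fin n)) : Prop :=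
  ∀ ν, (B ν).part = ν

/-- A forest-basis is a chromatic-basis all of whose graphs are forests. -/
def IsForestBasis {n : ℕ} (B : n.Partition → SimpleGraph (Fin n)) : Prop :=
  IsChromaticBasis B ∧ ∀ ν, (B ν).IsAcyclic

/-- `c` is a family of coefficients of an expansion `X_G = ∑_ν c_ν X_{B ν}`. -/
def IsCSFExpansion {n : ℕ} (B : n.Partition → SimpleGraph (Fin n)) (G : SimpleGraph (Fin n))
    (c : n.Partition → ℚ) : Prop :=
  G.csf = ∑ ν, c ν • (B ν).csf

/-- The coefficients `ν ↦ [ν]X_{G, B}` of `X_G` expressed in the chromatic-basis `B`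
(the family `c` with `X_G = ∑_ν c_ν X_{B ν}`). -/
noncomputable def csfCoeff {n : ℕ} (B : n.Partition → SimpleGraph (Fin n))
    (G : SimpleGraph (Fin n)) : n.Partition → ℚ :=
  Classical.epsilon (IsCSFExpansion B G)

/-- The truncation `X^k_{G, B} = ∑_{ν ⊢ n, ℓ(ν) ≤ ℓ(Part(G)) + k} [ν]X_{G, B} X_{B ν}`. -/
noncomputable def csfTrunc {n : ℕ} (B : n.Partition → SimpleGraph (Fin n))
    (G : SimpleGraph (Fin n)) (k : ℕ) : MvPowerSeries ℕ+ ℚ :=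
  ∑ ν : n.Partition with ν.length ≤ G.part.length + k, csfCoeff B G ν • (B ν).csf

/-!
For a forest `F`, both `X_F` (by Stanley's power sum expansion) and `U_F` are linear images of one
vector: the numbers `partCount F ν` of spanning subgraphs of `F` with partition `ν`. The map to
chromatic symmetric functions is injective, and `partCount F ν` is unitriangular with respect to
the length of partitions, so it suffices to study these vectors.

Two forests with the same partition can be joined by basis exchanges, each of which slides the ends
of an edge along the forest. Sliding one end of an edge along an adjacent edge changes `partCount`
by the difference of two forests with one more component, by deletion-contraction in a triangle.
Hence, modulo such differences, a forest may be replaced by the basis forest with its partition. If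
the entries of a combination of differences of forests with `L` components vanish at length `L`,
the basis forests cancel, and it is a combination of differences of forests with `L + 1`
components.
-/

namespace ChromaticSymmetric

open SimpleGraph

theorem exists_equiv_comp_eq {α β γ : Type*} [Fintype α] [Fintype β] {f : α → γ} {g : β → γ}
    (h : Finset.univ.val.map f = Finset.univ.val.map g) : ∃ e : α ≃ β, ∀ a, g (e a) = f a := by
  classical
  have hcard (c : γ) : Fintype.card {a // f a = c} = Fintype.card {b // g b = c} := by
    simpa only [Multiset.count_map, Fintype.card_subtype, Finset.card_def, Finset.filter_val,
      eq_comm (a := c)] using congrArg (Multiset.count c) h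
  exact ⟨Equiv.ofFiberEquiv fun c => Fintype.equivOfCardEq (hcard c), Equiv.ofFiberEquiv_map _⟩

theorem linearIndependent_of_triangular {R ι α M : Type*} [Ring R] [NoZeroDivisors R]
    [LinearOrder α] [AddCommGroup M] [Module R M] {v : ι → M} (φ : ι → M →ₗ[R] R) (rank : ι → α)
    (hdiag : ∀ i, φ i (v i) ≠ 0) (hoff : ∀ i j, i ≠ j → rank j ≤ rank i → φ j (v i) = 0) :
    LinearIndependent R v := by
  classical
  rw [linearIndependent_iff']
  intro s g hg
  by_contra! ⟨i, his, hi⟩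
  obtain ⟨j, hj, hmin⟩ := Finset.exists_min_image (s.filter fun i => g i ≠ 0) rank
    ⟨i, Finset.mem_filter.mpr ⟨his, hi⟩⟩
  obtain ⟨hjs, hgj⟩ := Finset.mem_filter.mp hj
  have hφ : ∑ i ∈ s, g i * φ j (v i) = g j * φ j (v j) := by
    refine Finset.sum_eq_single_of_mem j hjs fun i his hij => ?_
    by_cases hgi : g i = 0
    · rw [hgi, zero_mul]
    · rw [hoff i j hij (hmin i (Finset.mem_filter.mpr ⟨his, hgi⟩)), mul_zero]
  refine mul_ne_zero hgj (hdiag j) ?_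
  rw [← hφ]
  simpa only [map_sum, map_smul, smul_eq_mul, map_zero] using congrArg (φ j) hg

section Components

variable {V : Type*} {F G H : SimpleGraph V} {a b c d u v : V}

theorem exists_sup_edge_eq_of_adj (hG : G.IsAcyclic) (h : G.Adj u v) :
    ∃ G₀ : SimpleGraph V, ¬ G₀.Reachable u v ∧ G₀ ⊔ edge u v = G :=
  ⟨G \ edge u v, isAcyclic_iff_forall_adj_isBridge.mp hG h,
    sdiff_sup_cancel ((edge_le_iff ..).mpr (Or.inr h))⟩

theorem reachable_sup_edge (G : SimpleGraph V) (u v : V) : (G ⊔ edge u v).Reachable u v := by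
  obtain rfl | huv := eq_or_ne u v
  · exact .refl u
  · exact Adj.reachable (by simp [edge_adj, huv])

theorem reachable_sup_edge_iff : (G ⊔ edge u v).Reachable a b ↔ G.Reachable a b ∨
    (G.Reachable a u ∧ G.Reachable v b) ∨ (G.Reachable a v ∧ G.Reachable u b) := by
  constructor
  · rintro ⟨p⟩
    induction p with
    | nil => exact Or.inl (.refl _)
    | @cons a c b hac _ ih =>
      rcases hac with hac | hac
      · have step {x : V} : G.Reachable c x → G.Reachable a x := hac.reachable.trans
        exact ih.imp step (Or.imp (And.imp_left step) (And.imp_left step))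
      · rcases ((edge_adj ..).mp hac).1 with ⟨rfl, rfl⟩ | ⟨rfl, rfl⟩
        · rcases ih with ih | ⟨-, ih⟩ | ⟨-, ih⟩
          exacts [.inr (.inl ⟨.refl _, ih⟩), .inr (.inl ⟨.refl _, ih⟩), .inl ih]
        · rcases ih with ih | ⟨-, ih⟩ | ⟨-, ih⟩
          exacts [.inr (.inr ⟨.refl _, ih⟩), .inl ih, .inr (.inr ⟨.refl _, ih⟩)]
  · have mono {x y : V} (h : G.Reachable x y) : (G ⊔ edge u v).Reachable x y := h.mono le_sup_left
    have huv := reachable_sup_edge G u v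
    rintro (h | ⟨h₁, h₂⟩ | ⟨h₁, h₂⟩)
    exacts [mono h, (mono h₁).trans (huv.trans (mono h₂)),
      (mono h₁).trans (huv.symm.trans (mono h₂))]

theorem reachable_sup_edge_le (hac : G.Reachable a c) (hbd : G.Reachable b d) :
    (G ⊔ edge a b).Reachable ≤ (G ⊔ edge c d).Reachable := by
  have hab : (G ⊔ edge c d).Reachable a b :=
    (hac.mono le_sup_left).trans ((reachable_sup_edge G c d).trans (hbd.symm.mono le_sup_left))
  rintro x y hxy
  have mono {s t : V} (h : G.Reachable s t) : (G ⊔ edge c d).Reachable s t := h.mono le_sup_left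
  rcases reachable_sup_edge_iff.mp hxy with h | ⟨h₁, h₂⟩ | ⟨h₁, h₂⟩
  exacts [mono h, (mono h₁).trans (hab.trans (mono h₂)), (mono h₁).trans (hab.symm.trans (mono h₂))]

theorem reachable_sup_edge_congr (hac : G.Reachable a c) (hbd : G.Reachable b d) :
    (G ⊔ edge a b).Reachable = (G ⊔ edge c d).Reachable :=
  le_antisymm (reachable_sup_edge_le hac hbd) (reachable_sup_edge_le hac.symm hbd.symm)

theorem exists_adj_crossing (hH : H.Reachable a b) (hab : ¬ F.Reachable a b)
    (h : H.Reachable ≤ (F ⊔ edge a b).Reachable) :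
    ∃ c d, H.Adj c d ∧ F.Reachable a c ∧ F.Reachable b d := by
  obtain ⟨p⟩ := hH
  obtain ⟨⟨⟨c, d⟩, hcd⟩, -, hac, had⟩ :=
    p.exists_boundary_dart {x | F.Reachable a x} (.refl a) hab
  refine ⟨c, d, hcd, hac, ?_⟩
  rcases reachable_sup_edge_iff.mp (h c d hcd.reachable) with hcd | ⟨-, hbd⟩ | ⟨-, had'⟩
  exacts [absurd (hac.trans hcd) had, hbd, absurd had' had]

theorem sup_edge_sdiff_lt (hcd : H.Adj c d) (hab : a ≠ b) (hF : ¬ F.Adj a b) (hH : ¬ H.Adj a b) :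
    (F ⊔ edge c d) \ H < (F ⊔ edge a b) \ H := by
  rw [sup_sdiff, sup_sdiff, sdiff_eq_bot_iff.mpr ((edge_le_iff ..).mpr (Or.inr hcd)), sup_bot_eq]
  refine lt_of_le_not_ge le_sup_left fun hle => hF ?_
  have h : (F \ H).Adj a b := hle (Or.inr ⟨by simp [edge_adj, hab], hH⟩)
  exact h.1

theorem eq_of_le_of_reachable_eq (hF : F.IsAcyclic) (hle : H ≤ F)
    (h : H.Reachable = F.Reachable) : H = F :=
  le_antisymm hle
    (((maximal_isAcyclic_iff_reachable_eq hle (hF.anti hle)).mpr h).le_of_ge ⟨le_rfl, hF⟩ hle)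

theorem edgeSet_fromEdgeSet_of_subset {A : Set (Sym2 V)} (hA : A ⊆ F.edgeSet) :
    (fromEdgeSet A).edgeSet = A := by
  rw [edgeSet_fromEdgeSet, sdiff_eq_left, Set.disjoint_left]
  exact fun e he => F.not_isDiag_of_mem_edgeSet (hA he)

variable [Finite V]

theorem reachable_eq_of_le_of_card_le (hle : H ≤ G)
    (hcard : Nat.card H.ConnectedComponent ≤ Nat.card G.ConnectedComponent) :
    H.Reachable = G.Reachable := by
  have hsurj := ConnectedComponent.surjective_map_ofLE hle
  have hbij := (Nat.bijective_iff_surjective_and_card _).mpr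
    ⟨hsurj, hcard.antisymm (Nat.card_le_card_of_surjective _ hsurj)⟩
  ext u v
  exact ⟨.mono hle, fun h => ConnectedComponent.exact (hbij.1 (ConnectedComponent.sound h))⟩

theorem card_connectedComponent_sup_edge (h : ¬ G.Reachable u v) :
    Nat.card (G ⊔ edge u v).ConnectedComponent + 1 = Nat.card G.ConnectedComponent := by
  let ofNe (c : {c : G.ConnectedComponent // c ≠ G.connectedComponentMk v}) :
      (G ⊔ edge u v).ConnectedComponent := c.1.map (Hom.ofLE le_sup_left)
  have hbij : Function.Bijective ofNe := by
    refine ⟨?_, fun c => ?_⟩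
    · rintro ⟨⟨a⟩, ha⟩ ⟨⟨b⟩, hb⟩ hab
      replace ha : ¬ G.Reachable a v := fun h => ha (ConnectedComponent.sound h)
      replace hb : ¬ G.Reachable b v := fun h => hb (ConnectedComponent.sound h)
      refine Subtype.ext (ConnectedComponent.sound ?_)
      rcases reachable_sup_edge_iff.mp (ConnectedComponent.exact hab) with hab | ⟨-, hvb⟩ | ⟨hav, -⟩
      exacts [hab, absurd hvb.symm hb, absurd hav ha]
    · obtain ⟨a, rfl⟩ := c.exists_rep
      by_cases hav : G.Reachable a v
      · refine ⟨⟨G.connectedComponentMk u, fun huv => h (ConnectedComponent.exact huv)⟩,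
          ConnectedComponent.sound ?_⟩
        exact reachable_sup_edge_iff.mpr (.inr (.inl ⟨.refl u, hav.symm⟩))
      · exact ⟨⟨G.connectedComponentMk a, fun hav' => hav (ConnectedComponent.exact hav')⟩, rfl⟩
  rw [← Nat.card_congr (Equiv.ofBijective ofNe hbij)]
  have hsing := Set.ncard_compl_add_ncard {G.connectedComponentMk v}
  rwa [Set.ncard_singleton] at hsing

theorem ncard_edgeSet_sup_edge (h : ¬ G.Reachable u v) :
    (G ⊔ edge u v).edgeSet.ncard = G.edgeSet.ncard + 1 := by
  have huv : u ≠ v := fun huv => h (huv ▸ .refl u)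
  have hadj : s(u, v) ∉ G.edgeSet := fun hadj => h (Adj.reachable hadj)
  rw [edgeSet_sup, edgeSet_edge_of_ne huv, Set.union_singleton, Set.ncard_insert_of_notMem hadj]

theorem ncard_edgeSet_add_card_connectedComponent (hG : G.IsAcyclic) :
    G.edgeSet.ncard + Nat.card G.ConnectedComponent = Nat.card V := by
  induction G using WellFoundedLT.induction with
  | _ G ih =>
    obtain rfl | hne := eq_or_ne G ⊥
    · rw [edgeSet_bot, Set.ncard_empty, zero_add]
      exact (Nat.card_congr (Equiv.ofBijective _
        ⟨fun a b hab => reachable_bot.mp (ConnectedComponent.exact hab), Quot.mk_surjective⟩)).symm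
    · obtain ⟨u, v, huv⟩ := ne_bot_iff_exists_adj.mp hne
      obtain ⟨G₀, hG₀, rfl⟩ := exists_sup_edge_eq_of_adj hG huv
      have hlt : G₀ < G₀ ⊔ edge u v := lt_sup_edge _ _ _ huv.ne fun h => hG₀ h.reachable
      have := ih G₀ hlt (hG.anti le_sup_left)
      have := card_connectedComponent_sup_edge hG₀
      have := ncard_edgeSet_sup_edge hG₀
      omega

end Components

section SubgraphSum

variable {V M : Type*} [Finite V] {F G : SimpleGraph V} {u v w : V}

/-- The sum of `g H` over the spanning subgraphs `H` of `F`. Stanley's expansion of `X_F` and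
the definition of `U_F` are sums of this shape. -/
noncomputable def subgraphSum [AddCommMonoid M] (g : SimpleGraph V → M) (F : SimpleGraph V) : M :=
  ∑ H ∈ (Set.toFinite (Set.Iic F)).toFinset, g H

theorem subgraphSum_congr [AddCommMonoid M] {g g' : SimpleGraph V → M}
    (h : ∀ H ≤ F, g H = g' H) : subgraphSum g F = subgraphSum g' F :=
  Finset.sum_congr rfl fun H hH => h H (by simpa using hH)

theorem subgraphSum_comap {W : Type*} [Finite W] [AddCommMonoid M] (g : SimpleGraph V → M)
    (e : V ≃ W) (F : SimpleGraph W) :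
    subgraphSum g (F.comap e) = subgraphSum (fun H => g (H.comap e)) F := by
  have hinv (H : SimpleGraph V) : (H.comap e.symm).comap e = H := by ext; simp
  have hinv' (H : SimpleGraph W) : (H.comap e).comap e.symm = H := by ext; simp
  have hle (H : SimpleGraph V) : H ≤ F.comap e ↔ H.comap e.symm ≤ F :=
    ⟨fun h => hinv' F ▸ fun _ _ hab => h hab, fun h => hinv H ▸ fun _ _ hab => h hab⟩
  refine Finset.sum_nbij' (fun H => H.comap e.symm) (fun H => H.comap e) ?_ ?_
    (fun H _ => hinv H) (fun H _ => hinv' H) fun H _ => by rw [hinv]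
  · simp [hle]
  · simp [hle, hinv']

theorem subgraphSum_eq_sum_powerset [AddCommMonoid M] (g : SimpleGraph V → M)
    (F : SimpleGraph V) [Fintype F.edgeSet] :
    subgraphSum g F = ∑ A ∈ F.edgeFinset.powerset, g (fromEdgeSet (A : Set (Sym2 V))) := by
  have hle {A : Finset (Sym2 V)} : A ∈ F.edgeFinset.powerset ↔ (A : Set (Sym2 V)) ⊆ F.edgeSet := by
    rw [Finset.mem_powerset, ← Finset.coe_subset, coe_edgeFinset]
  refine Finset.sum_nbij' (fun H => (Set.toFinite H.edgeSet).toFinset)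
    (fun A => fromEdgeSet (A : Set (Sym2 V))) ?_ ?_ ?_ ?_ ?_
  · intro H hH
    simpa [hle] using hH
  · intro A hA
    rw [hle] at hA
    simpa [← edgeSet_subset_edgeSet, edgeSet_fromEdgeSet_of_subset hA] using hA
  · intro H _
    simp
  · intro A hA
    apply Finset.coe_injective
    rw [Set.Finite.coe_toFinset, edgeSet_fromEdgeSet_of_subset (hle.mp hA)]
  · intro H _
    simp

theorem subgraphSum_sup_edge [AddCommMonoid M] (g : SimpleGraph V → M) (huv : u ≠ v)
    (h : ¬ F.Adj u v) :
    subgraphSum g (F ⊔ edge u v) = subgraphSum g F + subgraphSum (fun H => g (H ⊔ edge u v)) F := by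
  classical
  have := Fintype.ofFinite V
  have hmem : s(u, v) ∉ F.edgeFinset := by rwa [mem_edgeFinset]
  simp only [subgraphSum_eq_sum_powerset]
  rw [edgeFinset_sup_edge F h huv, Finset.cons_eq_insert, Finset.sum_powerset_insert hmem]
  simp only [edge, fromEdgeSet_union, Finset.coe_insert, ← Set.union_singleton]

theorem subgraphSum_neg_one_pow (R : Type*) [CommRing R] (F : SimpleGraph V) [Decidable (F = ⊥)] :
    subgraphSum (fun H => (-1 : R) ^ H.edgeSet.ncard) F = if F = ⊥ then 1 else 0 := by
  classical
  have := Fintype.ofFinite V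
  calc subgraphSum (fun H => (-1 : R) ^ H.edgeSet.ncard) F
    _ = ∑ A ∈ F.edgeFinset.powerset, (-1 : R) ^ A.card := by
      rw [subgraphSum_eq_sum_powerset]
      refine Finset.sum_congr rfl fun A hA => ?_
      rw [Finset.mem_powerset, ← Finset.coe_subset, coe_edgeFinset] at hA
      rw [edgeSet_fromEdgeSet_of_subset hA, Set.ncard_coe_finset]
    _ = if F = ⊥ then 1 else 0 := by
      have := congrArg (Int.cast : ℤ → R) (Finset.sum_powerset_neg_one_pow_card (x := F.edgeFinset))
      simpa only [Int.cast_sum, Int.cast_pow, Int.cast_neg, Int.cast_one, Int.cast_ite,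
        Int.cast_zero, edgeFinset_eq_empty] using this

theorem subgraphSum_neg_one_pow_of_disjoint (R : Type*) [CommRing R] (F C : SimpleGraph V)
    [Decidable (F ≤ C)] [DecidablePred fun H : SimpleGraph V => Disjoint H C] :
    subgraphSum (fun H => (-1 : R) ^ H.edgeSet.ncard * if Disjoint H C then 1 else 0) F =
      if F ≤ C then 1 else 0 := by
  classical
  simp only [← sdiff_eq_bot_iff, ← subgraphSum_neg_one_pow R (F \ C)]
  simp only [subgraphSum, mul_ite, mul_one, mul_zero, ← Finset.sum_filter]
  congr 1
  ext H
  simp [le_sdiff]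

/-- The deletion-contraction terms of the two sides agree because `H ⊔ edge v w ⊔ edge u v` and
`H ⊔ edge u w ⊔ edge u v` have the same components. -/
theorem subgraphSum_sub_eq_of_triangle [AddCommGroup M] {g : SimpleGraph V → M}
    (hg : ∀ H K : SimpleGraph V, H.Reachable = K.Reachable → g H = g K)
    (huv : ¬ F.Reachable u v) (hvw : ¬ F.Reachable v w) (huw : ¬ F.Reachable u w) :
    subgraphSum g (F ⊔ edge u v ⊔ edge v w) - subgraphSum g (F ⊔ edge u v ⊔ edge u w) =
      subgraphSum g (F ⊔ edge v w) - subgraphSum g (F ⊔ edge u w) := by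
  have ne {a b : V} (h : ¬ F.Reachable a b) : a ≠ b := fun hab => h (hab ▸ .refl a)
  have not_adj {a b : V} (h : ¬ F.Reachable a b) : ¬ F.Adj a b := fun hab => h hab.reachable
  have hg' (H : SimpleGraph V) : g (H ⊔ edge v w ⊔ edge u v) = g (H ⊔ edge u w ⊔ edge u v) := by
    rw [sup_right_comm H (edge v w), sup_right_comm H (edge u w)]
    exact hg _ _ (reachable_sup_edge_congr (reachable_sup_edge H u v).symm (.refl w))
  have hvw' : ¬ (F ⊔ edge v w).Adj u v := by
    simp [edge_adj, not_adj huv, ne huw, ne huv]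
  have huw' : ¬ (F ⊔ edge u w).Adj u v := by
    simp [edge_adj, not_adj huv, (ne huv).symm, ne hvw]
  rw [sup_right_comm F (edge u v), sup_right_comm F (edge u v),
    subgraphSum_sup_edge g (ne huv) hvw', subgraphSum_sup_edge g (ne huv) huw',
    subgraphSum_sup_edge (fun H => g (H ⊔ edge u v)) (ne hvw) (not_adj hvw),
    subgraphSum_sup_edge (fun H => g (H ⊔ edge u v)) (ne huw) (not_adj huw)]
  simp only [hg']
  abel

end SubgraphSum

section Part

variable {n : ℕ} {H K : SimpleGraph (Fin n)}

theorem part_length (G : SimpleGraph (Fin n)) : G.part.length = Nat.card G.ConnectedComponent := by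
  classical
  rw [Nat.card_eq_fintype_card, Nat.Partition.length, part, Multiset.card_map, Finset.card_val,
    Finset.card_univ]

theorem count_part (G : SimpleGraph (Fin n)) (i : ℕ) :
    G.part.parts.count i = Nat.card {c : G.ConnectedComponent // c.supp.ncard = i} := by
  classical
  rw [Nat.card_eq_fintype_card, Fintype.card_subtype]
  simp only [part, Multiset.count_map, Finset.card_def, Finset.filter_val, eq_comm (a := i)]

theorem part_eq_of_reachable_iff (σ : Equiv.Perm (Fin n))
    (h : ∀ u v, H.Reachable u v ↔ K.Reachable (σ u) (σ v)) : H.part = K.part := by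
  classical
  let e : H.ConnectedComponent ≃ K.ConnectedComponent := Quot.congr σ h
  have he (c : H.ConnectedComponent) : (e c).supp = σ '' c.supp := by
    induction c using ConnectedComponent.ind with | _ a =>
    ext b
    rw [Equiv.image_eq_preimage_symm, Set.mem_preimage, ConnectedComponent.mem_supp_iff,
      ConnectedComponent.mem_supp_iff, ConnectedComponent.eq, h, Equiv.apply_symm_apply]
    exact ConnectedComponent.eq
  apply Nat.Partition.ext
  simp only [part]
  rw [← Finset.map_univ_equiv e, Finset.map_val, Multiset.map_map]
  refine Multiset.map_congr rfl fun c _ => ?_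
  rw [Function.comp_apply, Equiv.coe_toEmbedding, he, Set.ncard_image_of_injective _ σ.injective]

theorem part_eq_of_reachable_eq (h : H.Reachable = K.Reachable) : H.part = K.part :=
  part_eq_of_reachable_iff (Equiv.refl _) fun u v => by rw [h]; rfl

theorem exists_perm_reachable_iff_of_part_eq (h : H.part = K.part) :
    ∃ σ : Equiv.Perm (Fin n), ∀ u v, H.Reachable u v ↔ K.Reachable (σ u) (σ v) := by
  classical
  obtain ⟨e, he⟩ := exists_equiv_comp_eq (f := fun c : H.ConnectedComponent => c.supp.ncard)
    (g := fun c : K.ConnectedComponent => c.supp.ncard) (congrArg Nat.Partition.parts h)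
  have hcard (c : K.ConnectedComponent) :
      Fintype.card {v // e (H.connectedComponentMk v) = c} =
        Fintype.card {v // K.connectedComponentMk v = c} := by
    obtain ⟨c, rfl⟩ := e.surjective c
    simp only [e.apply_eq_iff_eq, ← Nat.card_eq_fintype_card]
    exact (he c).symm
  let σ : Equiv.Perm (Fin n) := Equiv.ofFiberEquiv fun c => Fintype.equivOfCardEq (hcard c)
  have hσ (v : Fin n) : K.connectedComponentMk (σ v) = e (H.connectedComponentMk v) :=
    Equiv.ofFiberEquiv_map _ v
  refine ⟨σ, fun u v => ?_⟩
  rw [← ConnectedComponent.eq, ← ConnectedComponent.eq, hσ, hσ, e.apply_eq_iff_eq]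

theorem reachable_eq_of_le_of_length_le (hle : H ≤ K) (hlen : H.part.length ≤ K.part.length) :
    H.Reachable = K.Reachable := by
  rw [part_length, part_length] at hlen
  exact reachable_eq_of_le_of_card_le hle hlen

theorem length_part_sup_edge {u v : Fin n} (h : ¬ H.Reachable u v) :
    (H ⊔ edge u v).part.length + 1 = H.part.length := by
  rw [part_length, part_length, card_connectedComponent_sup_edge h]

theorem ncard_edgeSet_eq_sub_length (hH : H.IsAcyclic) :
    H.edgeSet.ncard = n - H.part.length := by
  have := ncard_edgeSet_add_card_connectedComponent hH
  rw [← part_length, Nat.card_fin] at this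
  omega

end Part

section PartCount

variable {n : ℕ} {F : SimpleGraph (Fin n)} {u v w : Fin n}

/-- The vector of the numbers of spanning subgraphs of `F` with a given partition. For a forest,
both invariants of the theorem are linear images of it. -/
noncomputable def partCount (F : SimpleGraph (Fin n)) : n.Partition → ℚ :=
  open scoped Classical in subgraphSum (fun H => Pi.single H.part 1) F

theorem linearCombination_partCount {M : Type*} [AddCommGroup M] [Module ℚ M]
    (q : n.Partition → M) (F : SimpleGraph (Fin n)) :
    Fintype.linearCombination ℚ q (partCount F) = subgraphSum (fun H => q H.part) F := by
  rw [partCount, subgraphSum, map_sum]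
  refine Finset.sum_congr rfl fun H _ => ?_
  rw [Fintype.linearCombination_apply_single, one_smul]

open scoped Classical in
theorem partCount_apply (F : SimpleGraph (Fin n)) (ν : n.Partition) :
    partCount F ν = subgraphSum (fun H => if ν = H.part then 1 else 0) F := by
  simp only [partCount, subgraphSum, Finset.sum_apply, Pi.single_apply]

theorem partCount_apply_eq_zero {ν : n.Partition} (hlen : ν.length ≤ F.part.length)
    (hne : ν ≠ F.part) : partCount F ν = 0 := by
  rw [partCount_apply, subgraphSum]
  refine Finset.sum_eq_zero fun H hH => if_neg ?_
  rintro rfl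
  exact hne (part_eq_of_reachable_eq (reachable_eq_of_le_of_length_le (by simpa using hH) hlen))

theorem partCount_part (hF : F.IsAcyclic) : partCount F F.part = 1 := by
  rw [partCount_apply, subgraphSum, Finset.sum_eq_single_of_mem F (by simp), if_pos rfl]
  refine fun H hH hne => if_neg fun hpart => hne ?_
  have hle : H ≤ F := by simpa using hH
  exact eq_of_le_of_reachable_eq hF hle (reachable_eq_of_le_of_length_le hle (by rw [hpart]))

theorem partCount_comap (F : SimpleGraph (Fin n)) (σ : Equiv.Perm (Fin n)) :
    partCount (F.comap σ) = partCount F := by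
  have hpart (H : SimpleGraph (Fin n)) : (H.comap σ).part = H.part :=
    part_eq_of_reachable_iff σ fun u v => (Iso.comap σ H).reachable_iff.symm
  simp only [partCount, subgraphSum_comap, hpart]

theorem partCount_sub_eq_of_triangle (huv : ¬ F.Reachable u v) (hvw : ¬ F.Reachable v w)
    (huw : ¬ F.Reachable u w) :
    partCount (F ⊔ edge u v ⊔ edge v w) - partCount (F ⊔ edge u v ⊔ edge u w) =
      partCount (F ⊔ edge v w) - partCount (F ⊔ edge u w) :=
  subgraphSum_sub_eq_of_triangle (fun H K h => by rw [part_eq_of_reachable_eq h]) huv hvw huw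

end PartCount

section ForestLattice

variable {n L : ℕ} {F K : SimpleGraph (Fin n)} {a b c d u v w : Fin n}

/-- The lattice of integer combinations with coefficient sum zero of the vectors `partCount P`, for
forests `P` with `L` components. -/
def forestLattice (n L : ℕ) : AddSubgroup (n.Partition → ℚ) :=
  AddSubgroup.closure {x | ∃ P N : SimpleGraph (Fin n), (P.IsAcyclic ∧ P.part.length = L) ∧
    (N.IsAcyclic ∧ N.part.length = L) ∧ x = partCount P - partCount N}

theorem sub_mem_forestLattice (hF : F.IsAcyclic) (hFL : F.part.length = L) (hK : K.IsAcyclic)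
    (hKL : K.part.length = L) : partCount F - partCount K ∈ forestLattice n L :=
  AddSubgroup.subset_closure ⟨F, K, ⟨hF, hFL⟩, ⟨hK, hKL⟩, rfl⟩

theorem partCount_slide_along_adj (hF : F.IsAcyclic) (huv : F.Adj u v) (hvw : ¬ F.Reachable v w) :
    partCount (F ⊔ edge v w) - partCount (F ⊔ edge u w) ∈ forestLattice n F.part.length := by
  obtain ⟨F₀, h₀, rfl⟩ := exists_sup_edge_eq_of_adj hF huv
  have hvw₀ : ¬ F₀.Reachable v w := fun h => hvw (h.mono le_sup_left)
  have huw₀ : ¬ F₀.Reachable u w := fun h =>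
    hvw ((reachable_sup_edge F₀ u v).symm.trans (h.mono le_sup_left))
  have hF₀ : F₀.IsAcyclic := hF.anti le_sup_left
  have hlen := length_part_sup_edge h₀
  have hlen_vw := length_part_sup_edge hvw₀
  have hlen_uw := length_part_sup_edge huw₀
  rw [partCount_sub_eq_of_triangle h₀ hvw₀ huw₀]
  exact sub_mem_forestLattice (hF₀.sup_edge_of_not_reachable hvw₀) (by omega)
    (hF₀.sup_edge_of_not_reachable huw₀) (by omega)

theorem partCount_slide (hF : F.IsAcyclic) (huv : F.Reachable u v) (hvw : ¬ F.Reachable v w) :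
    partCount (F ⊔ edge v w) - partCount (F ⊔ edge u w) ∈ forestLattice n F.part.length := by
  obtain ⟨p⟩ := huv
  induction p with
  | nil => rw [sub_self]; exact zero_mem _
  | @cons u x v hux p ih =>
    rw [← sub_add_sub_cancel _ (partCount (F ⊔ edge x w))]
    have hxw : ¬ F.Reachable x w := fun h => hvw (p.reachable.symm.trans h)
    exact add_mem (ih hvw) (partCount_slide_along_adj hF hux hxw)

theorem partCount_exchange (hF : F.IsAcyclic) (hac : F.Reachable a c) (hbd : F.Reachable b d)
    (hab : ¬ F.Reachable a b) :
    partCount (F ⊔ edge a b) - partCount (F ⊔ edge c d) ∈ forestLattice n F.part.length := by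
  have hcb : ¬ F.Reachable b c := fun h => hab (hac.trans h.symm)
  rw [← sub_add_sub_cancel _ (partCount (F ⊔ edge c b))]
  refine add_mem (partCount_slide hF hac.symm hab) ?_
  rw [edge_comm c b, edge_comm c d]
  exact partCount_slide hF hbd.symm hcb

theorem partCount_sub_mem_of_reachable_eq (hF : F.IsAcyclic) (hK : K.IsAcyclic)
    (h : F.Reachable = K.Reachable) :
    partCount F - partCount K ∈ forestLattice n (F.part.length + 1) := by
  induction hD : F \ K using WellFoundedLT.induction generalizing F with
  | _ D ih =>
    obtain hle | ⟨a, b, hab, habK⟩ : F ≤ K ∨ ∃ a b, F.Adj a b ∧ ¬ K.Adj a b := by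
      by_contra! hcon
      exact hcon.1 fun a b hab => hcon.2 a b hab
    · rw [eq_of_le_of_reachable_eq hK hle h, sub_self]
      exact zero_mem _
    obtain ⟨F₀, h₀, rfl⟩ := exists_sup_edge_eq_of_adj hF hab
    obtain ⟨c, d, hcd, hac, hbd⟩ := exists_adj_crossing (h ▸ hab.reachable) h₀ h.ge
    have hF₀ : F₀.IsAcyclic := hF.anti le_sup_left
    have hcd₀ : ¬ F₀.Reachable c d := fun h => h₀ (hac.trans (h.trans hbd.symm))
    have hreach := reachable_sup_edge_congr hac hbd
    have hlt : (F₀ ⊔ edge c d) \ K < D :=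
      hD ▸ sup_edge_sdiff_lt hcd hab.ne (fun h => h₀ h.reachable) habK
    have hmem := ih _ hlt (hF₀.sup_edge_of_not_reachable hcd₀) (hreach ▸ h) rfl
    rw [← part_eq_of_reachable_eq hreach] at hmem
    rw [← sub_add_sub_cancel _ (partCount (F₀ ⊔ edge c d))]
    refine add_mem ?_ hmem
    rw [length_part_sup_edge h₀]
    exact partCount_exchange hF₀ hac hbd h₀

theorem partCount_sub_mem_of_part_eq (hF : F.IsAcyclic) (hK : K.IsAcyclic)
    (h : F.part = K.part) : partCount F - partCount K ∈ forestLattice n (F.part.length + 1) := by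
  obtain ⟨σ, hσ⟩ := exists_perm_reachable_iff_of_part_eq h
  have hreach : F.Reachable = (K.comap σ).Reachable := by
    ext u v
    exact (hσ u v).trans (Iso.comap σ K).reachable_iff
  rw [← partCount_comap K σ]
  exact partCount_sub_mem_of_reachable_eq hF (hK.comap (Iso.comap σ K).toHom σ.injective) hreach

theorem sub_sum_mem_forestLattice {B : n.Partition → SimpleGraph (Fin n)} (hB : IsForestBasis B)
    {x : n.Partition → ℚ} (hx : x ∈ forestLattice n L) :
    x - ∑ ν with ν.length = L, x ν • partCount (B ν) ∈ forestLattice n (L + 1) := by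
  have leading {P : SimpleGraph (Fin n)} (hP : P.IsAcyclic) (hL : P.part.length = L) :
      ∑ ν with ν.length = L, partCount P ν • partCount (B ν) = partCount (B P.part) := by
    rw [Finset.sum_eq_single_of_mem P.part (by simpa using hL), partCount_part hP, one_smul]
    intro ν hν hne
    rw [partCount_apply_eq_zero (by simp_all) hne, zero_smul]
  induction hx using AddSubgroup.closure_induction with
  | mem x hx =>
    obtain ⟨P, N, ⟨hP, hPL⟩, ⟨hN, hNL⟩, rfl⟩ := hx
    simp only [Pi.sub_apply, sub_smul, Finset.sum_sub_distrib]
    rw [leading hP hPL, leading hN hNL, sub_sub_sub_comm]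
    have hPB := partCount_sub_mem_of_part_eq hP (hB.2 P.part) (hB.1 P.part).symm
    have hNB := partCount_sub_mem_of_part_eq hN (hB.2 N.part) (hB.1 N.part).symm
    rw [hPL] at hPB
    rw [hNL] at hNB
    exact sub_mem hPB hNB
  | zero => simp
  | add x y _ _ hx hy =>
    simp only [Pi.add_apply, add_smul, Finset.sum_add_distrib]
    rw [add_sub_add_comm]
    exact add_mem hx hy
  | neg x _ hx =>
    simp only [Pi.neg_apply, neg_smul, Finset.sum_neg_distrib]
    rw [← neg_sub']
    exact neg_mem hx

theorem mem_forestLattice_of_forall_eq_zero {B : n.Partition → SimpleGraph (Fin n)}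
    (hB : IsForestBasis B) {x : n.Partition → ℚ} (hx : x ∈ forestLattice n L) (k : ℕ)
    (h : ∀ ν : n.Partition, ν.length < L + k → x ν = 0) : x ∈ forestLattice n (L + k) := by
  induction k with
  | zero => exact hx
  | succ k ih =>
    have hmem := sub_sum_mem_forestLattice hB (ih fun ν hν => h ν (by omega))
    rwa [Finset.sum_eq_zero, sub_zero] at hmem
    intro ν hν
    rw [h ν (by simp_all), zero_smul]

theorem exists_eq_sum_of_mem_forestLattice {x : n.Partition → ℚ} (hx : x ∈ forestLattice n L) :
    ∃ (t : ℕ) (P N : Fin t → SimpleGraph (Fin n)),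
      (∀ i, (P i).IsAcyclic ∧ (P i).part.length = L) ∧
      (∀ i, (N i).IsAcyclic ∧ (N i).part.length = L) ∧
      x = ∑ i, partCount (P i) - ∑ i, partCount (N i) := by
  induction hx using AddSubgroup.closure_induction with
  | mem x hx =>
    obtain ⟨P, N, hP, hN, rfl⟩ := hx
    exact ⟨1, fun _ => P, fun _ => N, fun _ => hP, fun _ => hN, by simp⟩
  | zero => exact ⟨0, Fin.elim0, Fin.elim0, fun i => i.elim0, fun i => i.elim0, by simp⟩
  | add x y _ _ hx hy =>
    obtain ⟨t, P, N, hP, hN, rfl⟩ := hx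
    obtain ⟨t', P', N', hP', hN', rfl⟩ := hy
    refine ⟨t + t', Fin.append P P', Fin.append N N', ?_, ?_, ?_⟩
    · exact Fin.addCases (by simpa using hP) (by simpa using hP')
    · exact Fin.addCases (by simpa using hN) (by simpa using hN')
    · simp only [Fin.sum_univ_add, Fin.append_left, Fin.append_right]
      abel
  | neg x _ hx =>
    obtain ⟨t, P, N, hP, hN, rfl⟩ := hx
    exact ⟨t, N, P, hN, hP, by abel⟩

end ForestLattice

section PowerSum

variable {σ ι κ : Type*} [Fintype ι] [Fintype κ] {w : ι → ℕ}

/-- The exponent vector of the monomial `∏ i, x_{f i} ^ w i`. -/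
noncomputable def weightedMonomial (w : ι → ℕ) (f : ι → σ) : σ →₀ ℕ :=
  ∑ i, Finsupp.single (f i) (w i)

theorem support_weightedMonomial [DecidableEq σ] (hw : ∀ i, w i ≠ 0) (f : ι → σ) :
    (weightedMonomial w f).support = Finset.univ.image f := by
  ext s
  simp only [weightedMonomial, Finsupp.mem_support_iff, Finsupp.finsetSum_apply,
    Finsupp.single_apply, ne_eq, Finset.sum_eq_zero_iff, Finset.mem_univ, Finset.mem_image,
    true_and, true_implies, not_forall]
  exact exists_congr fun i => by simp [hw i]

theorem map_support_weightedMonomial (hw : ∀ i, w i ≠ 0) {f : ι → σ} (hf : f.Injective) :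
    (weightedMonomial w f).support.val.map (weightedMonomial w f) = Finset.univ.val.map w := by
  classical
  rw [support_weightedMonomial hw, Finset.image_val_of_injOn hf.injOn, Multiset.map_map]
  refine Multiset.map_congr rfl fun i _ => ?_
  simp [weightedMonomial, Finsupp.single_apply, hf.eq_iff]

theorem finite_setOf_weightedMonomial_eq (hw : ∀ i, w i ≠ 0) (m : σ →₀ ℕ) :
    {f : ι → σ | weightedMonomial w f = m}.Finite := by
  classical
  refine (Fintype.piFinset fun _ => m.support).finite_toSet.subset ?_
  rintro f rfl
  rw [Finset.mem_coe, Fintype.mem_piFinset, support_weightedMonomial hw]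
  exact fun i => Finset.mem_image_of_mem f (Finset.mem_univ i)

/-- Injectivity of `g` makes the support as large as possible, which forces `f` to be injective. -/
theorem map_eq_map_of_weightedMonomial_eq {w' : κ → ℕ} (hw : ∀ i, w i ≠ 0) (hw' : ∀ j, w' j ≠ 0)
    (hcard : Fintype.card ι ≤ Fintype.card κ) {f : ι → σ} {g : κ → σ} (hg : g.Injective)
    (h : weightedMonomial w f = weightedMonomial w' g) :
    Finset.univ.val.map w = Finset.univ.val.map w' := by
  classical
  have hsupp : (Finset.univ.image f).card = Fintype.card κ := by
    rw [← support_weightedMonomial hw, h, support_weightedMonomial hw',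
      Finset.card_image_of_injective _ hg, Finset.card_univ]
  have hf : f.Injective := by
    rw [← Set.injOn_univ, ← Finset.coe_univ, ← Finset.card_image_iff]
    exact le_antisymm Finset.card_image_le (hsupp ▸ hcard)
  rw [← map_support_weightedMonomial hw hf, h, map_support_weightedMonomial hw' hg]

/-- The product `∏ i, p_{w i}` of power sum symmetric functions, for positive weights `w`. Expanding
the product, the coefficient of a monomial counts the ways to choose a variable in each factor. -/
noncomputable def powerSum (σ : Type*) (w : ι → ℕ) : MvPowerSeries σ ℚ :=
  fun m => ({f : ι → σ | weightedMonomial w f = m}.ncard : ℚ)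

theorem powerSum_congr {w' : κ → ℕ} (h : Finset.univ.val.map w = Finset.univ.val.map w') :
    powerSum σ w = powerSum σ w' := by
  obtain ⟨e, he⟩ := exists_equiv_comp_eq h
  funext m
  refine congrArg Nat.cast (Nat.card_congr ((e.arrowCongr (Equiv.refl σ)).subtypeEquiv fun f => ?_))
  simp [weightedMonomial, ← e.sum_comp, he]

/-- The power sum symmetric function `p_ν` of a partition `ν`. -/
noncomputable def partitionPowerSum (σ : Type*) {n : ℕ} (ν : n.Partition) : MvPowerSeries σ ℚ :=
  powerSum σ fun i : ν.parts => (i : ℕ)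

theorem linearIndependent_partitionPowerSum (σ : Type*) [Infinite σ] (n : ℕ) :
    LinearIndependent ℚ fun ν : n.Partition => partitionPowerSum σ ν := by
  have hw (ν : n.Partition) (i : ν.parts) : (i : ℕ) ≠ 0 := (ν.parts_pos Multiset.coe_mem).ne'
  have hcard (ν : n.Partition) : Fintype.card ν.parts = ν.length := Multiset.card_coe _
  have hg (ν : n.Partition) : ∃ g : ν.parts → σ, g.Injective :=
    ⟨_, ((Fintype.equivFin _).toEmbedding.trans
      (Fin.valEmbedding.trans (Infinite.natEmbedding σ))).injective⟩
  choose g hg using hg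
  refine linearIndependent_of_triangular
    (fun ν => MvPowerSeries.coeff (weightedMonomial (fun i : ν.parts => (i : ℕ)) (g ν)))
    (fun ν => OrderDual.toDual ν.length) (fun ν => ?_) fun ν ρ hne hlen => ?_
  · refine Nat.cast_ne_zero.mpr (Set.ncard_ne_zero_of_mem (a := g ν) rfl ?_)
    exact finite_setOf_weightedMonomial_eq (hw ν) _
  · refine Nat.cast_eq_zero.mpr ?_
    rw [Set.eq_empty_of_forall_notMem (s := {f | _}) fun f hf => hne ?_, Set.ncard_empty]
    have hmap := map_eq_map_of_weightedMonomial_eq (hw ν) (hw ρ) (by simpa [hcard] using hlen)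
      (hg ρ) hf
    exact Nat.Partition.ext
      ((Multiset.map_univ_coe _).symm.trans (hmap.trans (Multiset.map_univ_coe _)))

end PowerSum

section Stanley

variable {V σ : Type*} {H : SimpleGraph V}

theorem disjoint_comap_top_iff {κ : V → σ} :
    Disjoint H ((⊤ : SimpleGraph σ).comap κ) ↔
      ∃ f : H.ConnectedComponent → σ, f ∘ H.connectedComponentMk = κ := by
  rw [disjoint_left]
  constructor
  · intro h
    have hwalk {a b : V} (p : H.Walk a b) : κ a = κ b := by
      induction p with
      | nil => rfl
      | cons hab _ ih => exact (not_not.mp (h _ _ hab)).trans ih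
    exact ⟨ConnectedComponent.lift κ fun a b p _ => hwalk p, rfl⟩
  · rintro ⟨f, rfl⟩ a b hab hne
    exact hne (congrArg f (ConnectedComponent.sound hab.reachable))

variable [Fintype V]

theorem weightedMonomial_comp_connectedComponentMk [Fintype H.ConnectedComponent]
    (f : H.ConnectedComponent → σ) :
    weightedMonomial (fun _ => 1) (f ∘ H.connectedComponentMk) =
      weightedMonomial (fun c => c.supp.ncard) f := by
  classical
  unfold weightedMonomial
  rw [← Finset.sum_fiberwise Finset.univ H.connectedComponentMk]
  refine Finset.sum_congr rfl fun c _ => ?_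
  rw [Finset.sum_congr rfl fun v hv => by
    rw [Function.comp_apply, (Finset.mem_filter.mp hv).2], Finset.sum_const, Finsupp.smul_single,
    smul_eq_mul, mul_one, ← Set.ncard_coe_finset, Finset.coe_filter_univ]
  rfl

theorem powerSum_ncard_supp_apply [Fintype H.ConnectedComponent] (m : σ →₀ ℕ) :
    powerSum σ (fun c : H.ConnectedComponent => c.supp.ncard) m =
      ({κ : V → σ | weightedMonomial (fun _ => 1) κ = m ∧
        Disjoint H ((⊤ : SimpleGraph σ).comap κ)}.ncard : ℚ) := by
  have hinj : Function.Injective fun f : H.ConnectedComponent → σ => f ∘ H.connectedComponentMk :=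
    Quot.mk_surjective.injective_comp_right
  rw [powerSum, ← Set.ncard_image_of_injective _ hinj]
  congr 2
  ext κ
  simp only [Set.mem_image, Set.mem_ofPred_eq, disjoint_comap_top_iff]
  constructor
  · rintro ⟨f, hf, rfl⟩
    exact ⟨(weightedMonomial_comp_connectedComponentMk f).trans hf, f, rfl⟩
  · rintro ⟨hκ, f, rfl⟩
    exact ⟨f, (weightedMonomial_comp_connectedComponentMk f).symm.trans hκ, rfl⟩

theorem csf_apply (F : SimpleGraph V) (m : ℕ+ →₀ ℕ) :
    F.csf m = ({κ : V → ℕ+ | weightedMonomial (fun _ => 1) κ = m ∧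
      F ≤ (⊤ : SimpleGraph ℕ+).comap κ}.ncard : ℚ) := by
  refine congrArg Nat.cast (Nat.card_congr ?_)
  exact
    { toFun := fun κ => ⟨κ.1, κ.2, fun _ _ h => κ.1.valid h⟩
      invFun := fun κ => ⟨Coloring.mk κ.1 fun h => κ.2.2 h, κ.2.1⟩
      left_inv := fun _ => rfl
      right_inv := fun _ => rfl }

open scoped Classical in
/-- Stanley's power sum expansion: expanding the indicator of proper colorings by
inclusion-exclusion over the monochromatic edges. -/
theorem csf_eq_subgraphSum (F : SimpleGraph V) :
    F.csf = subgraphSum (fun H => (-1 : ℚ) ^ H.edgeSet.ncard •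
      powerSum ℕ+ fun c : H.ConnectedComponent => c.supp.ncard) F := by
  funext m
  have hfin : {κ : V → ℕ+ | weightedMonomial (fun _ => 1) κ = m}.Finite :=
    finite_setOf_weightedMonomial_eq (fun _ => one_ne_zero) m
  have ncard_eq (p : (V → ℕ+) → Prop) :
      ({κ : V → ℕ+ | weightedMonomial (fun _ => 1) κ = m ∧ p κ}.ncard : ℚ) =
        ∑ κ ∈ hfin.toFinset, if p κ then 1 else 0 := by
    rw [Finset.sum_boole, ← Set.ncard_coe_finset]
    congr 2
    ext κ
    simp
  have apply_eq : subgraphSum (fun H => (-1 : ℚ) ^ H.edgeSet.ncard •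
        powerSum ℕ+ fun c : H.ConnectedComponent => c.supp.ncard) F m =
      subgraphSum (fun H => (-1 : ℚ) ^ H.edgeSet.ncard *
        powerSum ℕ+ (fun c : H.ConnectedComponent => c.supp.ncard) m) F := by
    unfold subgraphSum
    exact Finset.sum_apply m _ _
  rw [apply_eq, csf_apply, ncard_eq,
    Finset.sum_congr rfl fun κ _ => (subgraphSum_neg_one_pow_of_disjoint ℚ F _).symm]
  unfold subgraphSum
  rw [Finset.sum_comm]
  refine Finset.sum_congr rfl fun H _ => ?_
  rw [← Finset.mul_sum, ← ncard_eq, ← powerSum_ncard_supp_apply]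

end Stanley

section LinearMaps

variable {n : ℕ} {F : SimpleGraph (Fin n)}

/-- The linear map from vectors of partition counts to chromatic symmetric functions of forests. A
forest with partition `ν` has `n - ℓ(ν)` edges, which determines the signs in Stanley's
expansion. -/
noncomputable def csfMap (n : ℕ) : (n.Partition → ℚ) →ₗ[ℚ] MvPowerSeries ℕ+ ℚ :=
  Fintype.linearCombination ℚ fun ν => (-1 : ℚ) ^ (n - ν.length) • partitionPowerSum ℕ+ ν

theorem powerSum_ncard_supp (σ : Type*) (H : SimpleGraph (Fin n))
    [Fintype H.ConnectedComponent] :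
    powerSum σ (fun c : H.ConnectedComponent => c.supp.ncard) = partitionPowerSum σ H.part := by
  refine powerSum_congr (Eq.trans ?_ (Multiset.map_univ_coe H.part.parts).symm)
  rw [part]
  congr!

theorem csf_eq_csfMap (hF : F.IsAcyclic) : F.csf = csfMap n (partCount F) := by
  rw [csf_eq_subgraphSum, csfMap, linearCombination_partCount]
  refine subgraphSum_congr fun H hH => ?_
  rw [ncard_edgeSet_eq_sub_length (hF.anti hH)]
  rw [powerSum_ncard_supp]

theorem csfMap_injective (n : ℕ) : Function.Injective (csfMap n) := by
  have hli := (linearIndependent_partitionPowerSum ℕ+ n).units_smul fun ν => (-1) ^ (n - ν.length)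
  simpa [csfMap, Units.smul_def, Pi.smul_def'] using hli.fintypeLinearCombination_injective

/-- The linear map from vectors of partition counts to `U`-polynomials of forests. -/
noncomputable def uMap (n : ℕ) : (n.Partition → ℚ) →ₗ[ℚ] MvPolynomial ℕ (Polynomial ℚ) :=
  Fintype.linearCombination ℚ fun ν => MvPolynomial.monomial (Multiset.toFinsupp ν.parts) 1

theorem prod_X_pow_eq_monomial_part (R : Type*) [CommSemiring R] (G : SimpleGraph (Fin n)) :
    ∏ i ∈ Finset.Icc 1 n, (MvPolynomial.X i : MvPolynomial ℕ R) ^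
      Nat.card {c : G.ConnectedComponent // c.supp.ncard = i} =
      MvPolynomial.monomial (Multiset.toFinsupp G.part.parts) 1 := by
  rw [MvPolynomial.monomial_eq, map_one, one_mul,
    Finsupp.prod_of_support_subset (s := Finset.Icc 1 n) _ _ _ fun i _ => pow_zero _]
  · simp only [Multiset.toFinsupp_apply, count_part]
  · intro i hi
    rw [Multiset.toFinsupp_support, Multiset.mem_toFinset] at hi
    exact Finset.mem_Icc.mpr ⟨G.part.parts_pos hi, Nat.Partition.le_of_mem_parts hi⟩

theorem uPoly_eq_uMap (hF : F.IsAcyclic) : F.uPoly = uMap n (partCount F) := by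
  classical
  rw [uMap, linearCombination_partCount, subgraphSum_eq_sum_powerset, uPoly]
  refine Finset.sum_congr (by congr!) fun A hA => ?_
  rw [Finset.mem_powerset, ← Finset.coe_subset, coe_edgeFinset] at hA
  have hedges := edgeSet_fromEdgeSet_of_subset hA
  have hle : fromEdgeSet (A : Set (Sym2 (Fin n))) ≤ F := by
    rwa [← edgeSet_subset_edgeSet, hedges]
  have hcard := ncard_edgeSet_add_card_connectedComponent (hF.anti hle)
  rw [hedges, Set.ncard_coe_finset, Nat.card_fin] at hcard
  rw [Fintype.card_fin, hcard, Nat.sub_self, pow_zero, map_one, mul_one,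
    prod_X_pow_eq_monomial_part]

theorem coeff_uMap (x : n.Partition → ℚ) (ν : n.Partition) :
    (uMap n x).coeff (Multiset.toFinsupp ν.parts) = Polynomial.C (x ν) := by
  classical
  rw [uMap, Fintype.linearCombination_apply, MvPolynomial.coeff_sum,
    Finset.sum_eq_single_of_mem ν (Finset.mem_univ ν)]
  · rw [MvPolynomial.coeff_smul, MvPolynomial.coeff_monomial, if_pos rfl,
      Polynomial.smul_eq_C_mul, mul_one]
  · intro ρ _ hne
    rw [MvPolynomial.coeff_smul, MvPolynomial.coeff_monomial, if_neg, smul_zero]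
    exact fun h => hne (Nat.Partition.ext (Multiset.toFinsupp.injective h))

theorem uCoeff_eq (hF : F.IsAcyclic) (ν : n.Partition) :
    F.uCoeff ν = Polynomial.C (partCount F ν) := by
  rw [uCoeff, uPoly_eq_uMap hF, coeff_uMap]

end LinearMaps

section ForestBasis

variable {n m k : ℕ} {B : n.Partition → SimpleGraph (Fin n)} {F K : SimpleGraph (Fin n)}

theorem partCount_basis_self (hB : IsForestBasis B) (ν : n.Partition) :
    partCount (B ν) ν = 1 := by
  simpa only [hB.1 ν] using partCount_part (hB.2 ν)

theorem partCount_basis_eq_zero (hB : IsChromaticBasis B) {ν ρ : n.Partition}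
    (hlen : ρ.length ≤ ν.length) (hne : ν ≠ ρ) : partCount (B ν) ρ = 0 :=
  partCount_apply_eq_zero (by rwa [hB]) (by rw [hB]; exact hne.symm)

theorem linearIndependent_partCount (hB : IsForestBasis B) :
    LinearIndependent ℚ fun ν => partCount (B ν) := by
  refine linearIndependent_of_triangular (fun ν => LinearMap.proj ν) Nat.Partition.length
    (fun ν => ?_) fun ν ρ hne hlen => partCount_basis_eq_zero hB.1 hlen hne
  rw [LinearMap.proj_apply, partCount_basis_self hB]
  exact one_ne_zero

theorem isCSFExpansion_iff (hB : ∀ ν, (B ν).IsAcyclic) (hF : F.IsAcyclic) (c : n.Partition → ℚ) :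
    IsCSFExpansion B F c ↔ partCount F = ∑ ν, c ν • partCount (B ν) := by
  rw [IsCSFExpansion, ← (csfMap_injective n).eq_iff, csf_eq_csfMap hF, map_sum]
  simp only [map_smul, csf_eq_csfMap (hB _)]

theorem existsUnique_isCSFExpansion (hB : IsForestBasis B) (hF : F.IsAcyclic) :
    ∃! c : n.Partition → ℚ, IsCSFExpansion B F c := by
  have hli := linearIndependent_partCount hB
  have hspan := hli.span_eq_top_of_card_eq_finrank' (by simp)
  obtain ⟨c, hc⟩ := (Submodule.mem_span_range_iff_exists_fun ℚ).mp
    (hspan ▸ Submodule.mem_top (x := partCount F))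
  refine ⟨c, (isCSFExpansion_iff hB.2 hF c).mpr hc.symm, fun d hd => ?_⟩
  exact hli.fintypeLinearCombination_injective
    (((isCSFExpansion_iff hB.2 hF d).mp hd).symm.trans hc.symm)

theorem partCount_eq_sum_csfCoeff (hB : IsForestBasis B) (hF : F.IsAcyclic) :
    partCount F = ∑ ν, csfCoeff B F ν • partCount (B ν) :=
  (isCSFExpansion_iff hB.2 hF _).mp
    (Classical.epsilon_spec (existsUnique_isCSFExpansion hB hF).exists)

theorem csfCoeff_eq_of_csfTrunc_eq (hB : IsForestBasis B) (hpart : F.part = K.part)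
    (h : csfTrunc B F k = csfTrunc B K k) {ν : n.Partition} (hν : ν.length ≤ K.part.length + k) :
    csfCoeff B F ν = csfCoeff B K ν := by
  have hli : LinearIndependent ℚ fun ν => (B ν).csf := by
    simp only [csf_eq_csfMap (hB.2 _)]
    exact (linearIndependent_partCount hB).map_injOn (csfMap n) (csfMap_injective n).injOn
  rw [← sub_eq_zero, csfTrunc, csfTrunc, hpart, ← Finset.sum_sub_distrib] at h
  simp only [← sub_smul] at h
  exact sub_eq_zero.mp (linearIndependent_iff'.mp hli _ _ h ν (by simpa using hν))

/-- The basis vectors are unitriangular with respect to the length, so a combination agrees with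
its coefficients at the first length where these do not vanish. -/
theorem sum_smul_partCount_apply (hB : IsForestBasis B) {c : n.Partition → ℚ}
    (hc : ∀ ρ : n.Partition, ρ.length < m → c ρ = 0) {ν : n.Partition} (hν : ν.length ≤ m) :
    (∑ ρ, c ρ • partCount (B ρ)) ν = c ν := by
  rw [Finset.sum_apply, Finset.sum_eq_single_of_mem ν (Finset.mem_univ ν)]
  · rw [Pi.smul_apply, partCount_basis_self hB, smul_eq_mul, mul_one]
  · intro ρ _ hne
    rw [Pi.smul_apply, smul_eq_mul]
    obtain hρ | hρ := lt_or_ge ρ.length m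
    · rw [hc ρ hρ, zero_mul]
    · rw [partCount_basis_eq_zero hB.1 (hν.trans hρ) hne, mul_zero]

theorem partCount_sub_apply_eq_csfCoeff_sub (hB : IsForestBasis B) (hF : F.IsAcyclic)
    (hK : K.IsAcyclic) (h : ∀ ρ : n.Partition, ρ.length < m → csfCoeff B F ρ = csfCoeff B K ρ)
    {ν : n.Partition} (hν : ν.length ≤ m) :
    partCount F ν - partCount K ν = csfCoeff B F ν - csfCoeff B K ν := by
  rw [← Pi.sub_apply, partCount_eq_sum_csfCoeff hB hF, partCount_eq_sum_csfCoeff hB hK,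
    ← Finset.sum_sub_distrib]
  simp only [← sub_smul]
  exact sum_smul_partCount_apply hB (fun ρ hρ => sub_eq_zero.mpr (h ρ hρ)) hν

end ForestBasis

end ChromaticSymmetric

open ChromaticSymmetric

theorem mainTheorem8 (n : ℕ) (F₁ F₂ : SimpleGraph (Fin n)) (hF₁ : F₁.IsAcyclic)
    (hF₂ : F₂.IsAcyclic) (μ : n.Partition) (hμ₁ : F₁.part = μ) (hμ₂ : F₂.part = μ)
    (B : n.Partition → SimpleGraph (Fin n)) (hB : IsForestBasis B) (k : ℕ)
    (hk : csfTrunc B F₁ k - csfTrunc B F₂ k = 0) :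
    -- the coefficients `[ν]X_{F₁, B}` and `[ν]X_{F₂, B}` are well defined
    ((∃! c : n.Partition → ℚ, IsCSFExpansion B F₁ c) ∧
      (∃! c : n.Partition → ℚ, IsCSFExpansion B F₂ c)) ∧
    -- the same signed sum of forests at level `ℓ(μ) + k + 1` for `X` and for `U`
    (∃ (t : ℕ) (P N : Fin t → SimpleGraph (Fin n)),
      (∀ i, (P i).IsAcyclic ∧ (P i).part.length = μ.length + k + 1) ∧
      (∀ i, (N i).IsAcyclic ∧ (N i).part.length = μ.length + k + 1) ∧
      F₁.csf - F₂.csf = ∑ i, (P i).csf - ∑ i, (N i).csf ∧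
      F₁.uPoly - F₂.uPoly = ∑ i, (P i).uPoly - ∑ i, (N i).uPoly) ∧
    -- equality of the coefficient differences
    (∀ ν : n.Partition, ν.length ≤ μ.length + k + 1 →
      Polynomial.C (csfCoeff B F₁ ν - csfCoeff B F₂ ν) = F₁.uCoeff ν - F₂.uCoeff ν) := by
  subst hμ₂
  have hcoeff (ν : n.Partition) (hν : ν.length < F₂.part.length + k + 1) :
      csfCoeff B F₁ ν = csfCoeff B F₂ ν :=
    csfCoeff_eq_of_csfTrunc_eq hB hμ₁ (sub_eq_zero.mp hk) (Nat.lt_succ_iff.mp hν)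
  have hcount {ν : n.Partition} (hν : ν.length ≤ F₂.part.length + k + 1) :
      partCount F₁ ν - partCount F₂ ν = csfCoeff B F₁ ν - csfCoeff B F₂ ν :=
    partCount_sub_apply_eq_csfCoeff_sub hB hF₁ hF₂ hcoeff hν
  have hmem : partCount F₁ - partCount F₂ ∈ forestLattice n (F₂.part.length + (k + 1)) :=
    mem_forestLattice_of_forall_eq_zero hB (sub_mem_forestLattice hF₁ (by rw [hμ₁]) hF₂ rfl) _
      fun ν hν => (hcount hν.le).trans (sub_eq_zero.mpr (hcoeff ν hν))
  refine ⟨⟨existsUnique_isCSFExpansion hB hF₁, existsUnique_isCSFExpansion hB hF₂⟩, ?_, ?_⟩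
  · obtain ⟨t, P, N, hP, hN, hPN⟩ := exists_eq_sum_of_mem_forestLattice hmem
    refine ⟨t, P, N, hP, hN, ?_, ?_⟩
    · simpa only [csf_eq_csfMap, hF₁, hF₂, (hP _).1, (hN _).1, map_sub, map_sum] using
        congrArg (csfMap n) hPN
    · simpa only [uPoly_eq_uMap, hF₁, hF₂, (hP _).1, (hN _).1, map_sub, map_sum] using
        congrArg (uMap n) hPN
  · intro ν hν
    rw [uCoeff_eq hF₁, uCoeff_eq hF₂, ← Polynomial.C_sub, hcount hν]
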